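/- **Lemma.** Let $f:(0,\infty)\to[0,\infty)$ be a Bernstein function of the form $$f(\lambda)=\beta\lambda+\int_{(0,\infty)}\left(1-e^{-\lambda t}\right)\rho(dt),\qquad \lambda>0,$$ where $\beta\ge 0$ and $\rho$ is a measure on $(0,\infty)$ with $\int_{(0,\infty)}\min\{t,1\}\,\rho(dt)<\infty$. Let $(T_t)_{t\ge 0}$ be the corresponding subordinator, i.e. an increasing real-valued Lévy process started at $0$ such that $\mathbb{E}\,e^{-\lambda T_t}=e^{-tf(\lambda)}$ for all $t,\lambda>0$, and let $\alpha>0$. The following assertions are equivalent. (a) $\mathbb{E}\,e^{\alpha T_t}<\infty$ for some $t>0$. (a') $\mathbb{E}\,e^{\alpha T_t}<\infty$ for all $t>0$. (b) $\int_{(1,\infty)}e^{\alpha s}\,\rho(ds)<\infty$. (c) $f$ has an extension to $[-\alpha,\infty)$ which is continuous on $[-\alpha,\infty)$ and infinitely often differentiable on $(-\alpha,\infty)$, and whose derivatives satisfy $(-1)^{k+1}f^{(k)}\ge 0$ on $(-\alpha,\infty)$ for all integers $k\ge 1$. (d) $f$ has an extension to $[-\alpha,\infty)$ which is continuous on $[-\alpha,\infty)$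 and real-analytic on $(-\alpha,\infty)$. -/

import Mathlib

open MeasureTheory ProbabilityTheory Set
open scoped NNReal ENNReal

/-- `ρ` is a measure on `(0, ∞)` (as a measure on `ℝ` that does not charge `(-∞, 0]`) with
`∫_{(0, ∞)} min {t, 1} ρ(dt) < ∞`. -/
structure IsBernsteinLevyMeasure (ρ : Measure ℝ) : Prop where
  null_Iic : ρ (Iic 0) = 0
  lintegral_min_lt_top : ∫⁻ t in Ioi (0 : ℝ), ENNReal.ofReal (min t 1) ∂ρ < ∞

/-- `f : (0, ∞) → [0, ∞)` is the Bernstein function with drift `β` and Lévy measure `ρ`: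
`f(l) = β l + ∫_{(0, ∞)} (1 - e^{-l t}) ρ(dt)` for `l > 0`.
The function is given on all of `ℝ`, but its values outside of `(0, ∞)` are irrelevant. The
integrand is `ρ`-integrable, because it lies between `0` and `max {l, 1} * min {t, 1}`. -/
structure IsBernsteinFunction (f : ℝ → ℝ) (β : ℝ) (ρ : Measure ℝ) : Prop where
  drift_nonneg : 0 ≤ β
  levyMeasure : IsBernsteinLevyMeasure ρ
  eq_integral : ∀ l : ℝ, 0 < l →
    f l = β * l + ∫ t in Ioi (0 : ℝ), (1 - Real.exp (-(l * t))) ∂ρ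

/-- A subordinator: a real-valued Lévy process (started at `0`, with stationary and independent
increments and right-continuous trajectories) whose trajectories are increasing (so that left
limits exist automatically). Path properties are required almost surely. -/
structure IsSubordinator {Ω : Type*} [MeasurableSpace Ω] (T : ℝ≥0 → Ω → ℝ) (P : Measure Ω) :
    Prop where
  measurable : ∀ t, Measurable (T t)
  zero : ∀ᵐ ω ∂P, T 0 ω = 0
  monotone : ∀ᵐ ω ∂P, Monotone fun t => T t ω
  rightContinuous : ∀ᵐ ω ∂P, ∀ t, ContinuousWithinAt (fun s => T s ω) (Ici t) t
  indepIncrements : HasIndepIncrements T P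
  stationary : ∀ s t : ℝ≥0, IdentDistrib (fun ω => T (s + t) ω - T s ω) (T t) P P

/-- `T` is a subordinator corresponding to `f` via the Laplace transform:
`E e^{-l T_t} = e^{-t f(l)}` for all `t, l > 0`. -/
structure IsSubordinatorOf {Ω : Type*} [MeasurableSpace Ω] (T : ℝ≥0 → Ω → ℝ) (P : Measure Ω)
    (f : ℝ → ℝ) : Prop extends IsSubordinator T P where
  laplace : ∀ t : ℝ≥0, 0 < t → ∀ l : ℝ, 0 < l →
    ∫ ω, Real.exp (-(l * T t ω)) ∂P = Real.exp (-(t * f l))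

/-! Both moment conditions say that a nonnegative `X` under a finite measure has a finite
exponential moment: `T t` under `P`, and the identity under `ρ` on `(1, ∞)`. The two moment
generating functions at `s < 0` are `exp (-t f(-s))` and, up to a constant and the sign, `f(-s)`
minus the part of `f` coming from the drift and the jumps in `(0, 1]`, which is analytic everywhere.

Finite moment at `α` implies extension: the mgf is analytic on `(-∞, α)` and continuous up to `α`;
for `T t` a logarithm recovers `f`.

Analytic extension implies finite moment (Pringsheim, `mem_integrableExpSet_of_analyticOnNhd`): the
Taylor coefficients of an mgf are nonnegative moments over `n!`, so by Tonelli convergence of the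
Taylor series to the right of its centre is finiteness of the exponential moment. Fatou's lemma
reaches the end point.

In (c) analyticity is not assumed. There the signs of the derivatives make the Taylor polynomials of
`-F(-s)` lower bounds for the function, and its derivatives at `-1` dominate the moments of the
large jumps, which bounds the same series. -/

open Filter Topology

/-! ### Exponential moments of nonnegative functions and Pringsheim's theorem -/

section ExpMoments

variable {Ω : Type*} [MeasurableSpace Ω] {μ : Measure Ω} {X : Ω → ℝ}

/-- The exponential moment at `y + δ` as a Taylor series around an interior point `y`. -/
lemma lintegral_exp_add_mul_eq_tsum (hX : 0 ≤ᵐ[μ] X) {y δ : ℝ}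
    (hy : y ∈ interior (integrableExpSet X μ)) (hδ : 0 ≤ δ) :
    ∫⁻ ω, ENNReal.ofReal (Real.exp ((y + δ) * X ω)) ∂μ =
      ∑' n : ℕ, ENNReal.ofReal
        ((∫ ω, X ω ^ n * Real.exp (y * X ω) ∂μ) / (n.factorial : ℝ) * δ ^ n) := by
  have hXm : AEMeasurable X μ := aemeasurable_of_mem_interior_integrableExpSet hy
  have key : ∀ n : ℕ, ENNReal.ofReal
        ((∫ ω, X ω ^ n * Real.exp (y * X ω) ∂μ) / (n.factorial : ℝ) * δ ^ n) =
      ∫⁻ ω, ENNReal.ofReal (X ω ^ n * Real.exp (y * X ω) * (δ ^ n / n.factorial)) ∂μ := by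
    intro n
    rw [div_mul_eq_mul_div, mul_div_assoc, ← integral_mul_const,
      ofReal_integral_eq_lintegral_ofReal]
    · exact (integrable_pow_mul_exp_of_mem_interior_integrableExpSet hy n).mul_const _
    · filter_upwards [hX] with ω hω
      have : 0 ≤ X ω := hω
      simp only [Pi.zero_apply]
      positivity
  simp_rw [key]
  rw [← lintegral_tsum (fun n => by fun_prop)]
  refine lintegral_congr_ae ?_
  filter_upwards [hX] with ω hω
  have hω : 0 ≤ X ω := hω
  have hs := (NormedSpace.expSeries_div_hasSum_exp (δ * X ω)).mul_left (Real.exp (y * X ω))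
  rw [← Real.exp_eq_exp_ℝ, ← Real.exp_add] at hs
  have heq : ∀ n : ℕ, X ω ^ n * Real.exp (y * X ω) * (δ ^ n / n.factorial) =
      Real.exp (y * X ω) * ((δ * X ω) ^ n / n.factorial) := fun n => by rw [mul_pow]; ring
  simp_rw [heq]
  rw [← ENNReal.ofReal_tsum_of_nonneg (fun n => by positivity) hs.summable, hs.tsum_eq, add_mul]

/-- An exponential moment is finite if the moments to its left stay bounded by a function having
a limit. -/
lemma lintegral_exp_mul_lt_top_of_le (hXm : AEMeasurable X μ) {G : ℝ → ℝ} {a c : ℝ}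
    (hG : Tendsto G (𝓝[<] a) (𝓝 c))
    (hle : ∀ᶠ s in 𝓝[<] a,
      ∫⁻ ω, ENNReal.ofReal (Real.exp (s * X ω)) ∂μ ≤ ENNReal.ofReal (G s)) :
    ∫⁻ ω, ENNReal.ofReal (Real.exp (a * X ω)) ∂μ < ∞ := by
  obtain ⟨u, hu⟩ := exists_seq_tendsto (𝓝[<] a)
  have hua : Tendsto u atTop (𝓝 a) := hu.mono_right nhdsWithin_le_nhds
  have h1 : ∀ ω, liminf (fun n => ENNReal.ofReal (Real.exp (u n * X ω))) atTop =
      ENNReal.ofReal (Real.exp (a * X ω)) := fun ω =>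
    (ENNReal.tendsto_ofReal ((Real.continuous_exp.tendsto _).comp (hua.mul_const _))).liminf_eq
  calc ∫⁻ ω, ENNReal.ofReal (Real.exp (a * X ω)) ∂μ
      = ∫⁻ ω, liminf (fun n => ENNReal.ofReal (Real.exp (u n * X ω))) atTop ∂μ := by
        simp_rw [h1]
    _ ≤ liminf (fun n => ∫⁻ ω, ENNReal.ofReal (Real.exp (u n * X ω)) ∂μ) atTop :=
        lintegral_liminf_le' fun n => by fun_prop
    _ ≤ liminf (fun n => ENNReal.ofReal (G (u n))) atTop := liminf_le_liminf (hu.eventually hle)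
    _ = ENNReal.ofReal c := (ENNReal.tendsto_ofReal (hG.comp hu)).liminf_eq
    _ < ∞ := ENNReal.ofReal_lt_top

lemma mem_integrableExpSet_of_lintegral_lt_top (hXm : AEMeasurable X μ) {s : ℝ}
    (h : ∫⁻ ω, ENNReal.ofReal (Real.exp (s * X ω)) ∂μ < ∞) : s ∈ integrableExpSet X μ :=
  ⟨by fun_prop, (hasFiniteIntegral_iff_ofReal (ae_of_all _ fun _ => (Real.exp_pos _).le)).2 h⟩

lemma lintegral_exp_mul_eq_mgf {s : ℝ} (h : s ∈ integrableExpSet X μ) :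
    ∫⁻ ω, ENNReal.ofReal (Real.exp (s * X ω)) ∂μ = ENNReal.ofReal (mgf X μ s) :=
  (ofReal_integral_eq_lintegral_ofReal h (ae_of_all _ fun _ => (Real.exp_pos _).le)).symm

lemma mem_integrableExpSet_of_le (hXm : AEMeasurable X μ) (hX : 0 ≤ᵐ[μ] X) {s t : ℝ}
    (ht : t ∈ integrableExpSet X μ) (hst : s ≤ t) : s ∈ integrableExpSet X μ := by
  refine Integrable.mono' (show Integrable _ μ from ht) (by fun_prop) ?_
  filter_upwards [hX] with ω hω
  have hω : 0 ≤ X ω := hω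
  rw [Real.norm_eq_abs, Real.abs_exp]
  gcongr

lemma Iio_subset_interior_integrableExpSet (hXm : AEMeasurable X μ) (hX : 0 ≤ᵐ[μ] X) {t : ℝ}
    (ht : t ∈ integrableExpSet X μ) : Iio t ⊆ interior (integrableExpSet X μ) :=
  interior_maximal (fun _ hs => mem_integrableExpSet_of_le hXm hX ht (le_of_lt hs)) isOpen_Iio

lemma zero_mem_integrableExpSet [IsFiniteMeasure μ] : (0 : ℝ) ∈ integrableExpSet X μ := by
  simp [integrableExpSet]

lemma continuousOn_mgf_Iic (hXm : AEMeasurable X μ) (hX : 0 ≤ᵐ[μ] X) {t : ℝ}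
    (ht : t ∈ integrableExpSet X μ) : ContinuousOn (mgf X μ) (Iic t) := by
  intro s hs
  refine continuousWithinAt_of_dominated (bound := fun ω => Real.exp (t * X ω))
    (Eventually.of_forall fun s => by fun_prop) ?_ ht
    (ae_of_all _ fun ω => by fun_prop)
  filter_upwards [self_mem_nhdsWithin] with u hu
  filter_upwards [hX] with ω hω
  have hω : 0 ≤ X ω := hω
  have hu : u ≤ t := hu
  rw [Real.norm_eq_abs, Real.abs_exp]
  gcongr

/-- Identity theorem on the half-line; the functions already agree near `-1`. -/
lemma eqOn_mgf_Iio {G : ℝ → ℝ} {b : ℝ} (hb : 0 ≤ b)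
    (hS : Iio b ⊆ interior (integrableExpSet X μ)) (hG : AnalyticOnNhd ℝ G (Iio b))
    (heq : EqOn G (mgf X μ) (Iio 0)) : EqOn G (mgf X μ) (Iio b) :=
  hG.eqOn_of_preconnected_of_eventuallyEq (analyticOnNhd_mgf.mono hS) isPreconnected_Iio
    (show (-1 : ℝ) < b by linarith) (heq.eventuallyEq_of_mem (Iio_mem_nhds (by norm_num)))

/-- Pringsheim's theorem for moment generating functions of nonnegative random variables. -/
theorem mem_integrableExpSet_of_analyticOnNhd [IsFiniteMeasure μ] (hXm : AEMeasurable X μ)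
    (hX : 0 ≤ᵐ[μ] X) {G : ℝ → ℝ} {a : ℝ} (hG : AnalyticOnNhd ℝ G (Iio a))
    (heq : EqOn G (mgf X μ) (Iio 0)) {s : ℝ} (hs : s < a) : s ∈ integrableExpSet X μ := by
  by_contra hsS
  set S := integrableExpSet X μ with hSdef
  have hbdd : ∀ u ∈ S, u ≤ s := fun u hu => by
    by_contra! h
    exact hsS (mem_integrableExpSet_of_le hXm hX hu h.le)
  have hBA : BddAbove S := ⟨s, hbdd⟩
  have h0 : (0 : ℝ) ∈ S := zero_mem_integrableExpSet
  set b := sSup S with hb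
  have hb0 : 0 ≤ b := le_csSup hBA h0
  have hba : b < a := (csSup_le ⟨0, h0⟩ hbdd).trans_lt hs
  have hint : Iio b ⊆ interior S := by
    refine interior_maximal (fun u hu => ?_) isOpen_Iio
    obtain ⟨v, hv, huv⟩ := exists_lt_of_lt_csSup ⟨0, h0⟩ hu
    exact mem_integrableExpSet_of_le hXm hX hv huv.le
  have hGm := eqOn_mgf_Iio hb0 hint (hG.mono (Iio_subset_Iio hba.le)) heq
  obtain ⟨p, r, hp⟩ := hG b hba
  -- Recentring the series of `G` from `b` to `b - ε` leaves radius at least `r - ε > 2ε`, so it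
  -- still converges at `b + ε`, beyond the supremum `b`.
  obtain ⟨ε, hε, hεr⟩ : ∃ ε : ℝ≥0, 0 < ε ∧ (ε : ℝ≥0∞) + 2 * ε < r := by
    obtain ⟨q, hq, hqr⟩ := ENNReal.lt_iff_exists_nnreal_btwn.1 hp.r_pos
    refine ⟨q / 3, by simpa using hq, ?_⟩
    convert hqr using 1
    norm_cast
    ring
  have hεpos : (0 : ℝ) < ε := hε
  have hn1 : ‖(-(ε : ℝ))‖₊ = ε := by simp
  have hεlt : (ε : ℝ≥0∞) < r := lt_of_le_of_lt le_self_add hεr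
  have hq := hp.changeOrigin (y := -(ε : ℝ)) (by rw [hn1]; exact hεlt)
  have hyb : b + -(ε : ℝ) < b := by linarith
  have hq' : HasFPowerSeriesAt (mgf X μ) (p.changeOrigin (-(ε : ℝ))) (b + -(ε : ℝ)) :=
    hq.hasFPowerSeriesAt.congr (hGm.eventuallyEq_of_mem (Iio_mem_nhds hyb))
  -- Left of `b`, `G` is the mgf, so uniqueness of power series turns the recentred coefficients
  -- into moments over `n!`.
  have hpe := hq'.eq_formalMultilinearSeries (hasFPowerSeriesAt_mgf (hint hyb))
  have hmem : (2 * ε : ℝ) ∈ Metric.eball (0 : ℝ) (r - ‖-(ε : ℝ)‖₊) := by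
    rw [hn1, Metric.mem_eball, edist_zero_right]
    have : ‖(2 * ε : ℝ)‖ₑ = 2 * (ε : ℝ≥0∞) := by
      rw [enorm_mul]
      congr 1
      · simp [enorm]
      · simp [enorm]
    rw [this]
    exact lt_tsub_iff_left.2 hεr
  have hsum := (hq.hasSum hmem).summable
  rw [hpe] at hsum
  simp only [FormalMultilinearSeries.ofScalars_apply_eq, smul_eq_mul] at hsum
  have hmemS : b + -(ε : ℝ) + 2 * ε ∈ S := by
    refine mem_integrableExpSet_of_lintegral_lt_top hXm ?_
    rw [lintegral_exp_add_mul_eq_tsum hX (hint hyb) (by positivity),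
      ← ENNReal.ofReal_tsum_of_nonneg (fun n => ?_) hsum]
    · exact ENNReal.ofReal_lt_top
    · have : 0 ≤ ∫ ω, X ω ^ n * Real.exp ((b + -(ε : ℝ)) * X ω) ∂μ := by
        refine integral_nonneg_of_ae ?_
        filter_upwards [hX] with ω hω
        have hω : 0 ≤ X ω := hω
        simp only [Pi.zero_apply]
        positivity
      positivity
  have := le_csSup hBA hmemS
  linarith

/-- Pringsheim's theorem, including the end point. -/
theorem lintegral_exp_mul_lt_top_of_analyticOnNhd [IsFiniteMeasure μ] (hXm : AEMeasurable X μ)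
    (hX : 0 ≤ᵐ[μ] X) {G : ℝ → ℝ} {a : ℝ} (ha : 0 ≤ a) (hG : AnalyticOnNhd ℝ G (Iio a))
    (hGc : ContinuousWithinAt G (Iio a) a) (heq : EqOn G (mgf X μ) (Iio 0)) :
    ∫⁻ ω, ENNReal.ofReal (Real.exp (a * X ω)) ∂μ < ∞ := by
  have hS : Iio a ⊆ integrableExpSet X μ := fun s hs =>
    mem_integrableExpSet_of_analyticOnNhd hXm hX hG heq hs
  have hGm := eqOn_mgf_Iio ha (interior_maximal hS isOpen_Iio) hG heq
  refine lintegral_exp_mul_lt_top_of_le hXm hGc ?_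
  filter_upwards [self_mem_nhdsWithin] with s hs
  rw [lintegral_exp_mul_eq_mgf (hS hs), hGm hs]

end ExpMoments

/-! ### Taylor lower bounds and reflection of half-lines -/

/-- Taylor polynomials are lower bounds if all derivatives of positive order are nonnegative. -/
lemma sum_iteratedDeriv_succ_le_sub {K : ℝ → ℝ} {a s₀ s : ℝ} (hs₀ : s₀ < s) (hs : s < a)
    (hK : ContDiffOn ℝ (⊤ : ℕ∞) K (Iio a))
    (hpos : ∀ k : ℕ, ∀ x < a, 0 ≤ iteratedDeriv (k + 1) K x) (n : ℕ) :
    ∑ k ∈ Finset.range n, iteratedDeriv (k + 1) K s₀ / ((k + 1).factorial : ℝ) * (s - s₀) ^ (k + 1)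
      ≤ K s - K s₀ := by
  have hsub : uIcc s₀ s ⊆ Iio a := fun x hx => by
    rw [uIcc_of_le hs₀.le] at hx
    exact hx.2.trans_lt hs
  have hKn : ContDiffOn ℝ (n + 1) K (Iio a) := hK.of_le (by exact_mod_cast le_top)
  obtain ⟨ξ, hξ, h⟩ := taylor_mean_remainder_lagrange_iteratedDeriv hs₀.ne (hKn.mono hsub)
  have hξa : ξ < a := hsub (uIoo_subset_uIcc_self hξ)
  have hr : 0 ≤ iteratedDeriv (n + 1) K ξ * (s - s₀) ^ (n + 1) / ((n + 1).factorial : ℝ) := by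
    have := hpos n ξ hξa
    have : 0 ≤ s - s₀ := by linarith
    positivity
  have heq : ∀ k : ℕ, iteratedDerivWithin k K (uIcc s₀ s) s₀ = iteratedDeriv k K s₀ := fun k =>
    iteratedDerivWithin_eq_iteratedDeriv (uniqueDiffOn_uIcc hs₀.ne)
      ((hK.of_le (by exact_mod_cast le_top)).contDiffAt (Iio_mem_nhds (hs₀.trans hs)))
      left_mem_uIcc
  -- The term of order zero is split off, since `K` itself has no sign.
  rw [taylor_within_apply, Finset.sum_range_succ'] at h
  simp only [heq, iteratedDeriv_zero, smul_eq_mul] at h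
  simp only [Nat.factorial_zero, Nat.cast_one, inv_one, pow_zero, one_mul, mul_one] at h
  have : ∑ k ∈ Finset.range n,
      iteratedDeriv (k + 1) K s₀ / ((k + 1).factorial : ℝ) * (s - s₀) ^ (k + 1) =
      ∑ k ∈ Finset.range n,
      ((k + 1).factorial : ℝ)⁻¹ * (s - s₀) ^ (k + 1) * iteratedDeriv (k + 1) K s₀ :=
    Finset.sum_congr rfl fun k _ => by ring
  rw [this]
  linarith

lemma mapsTo_neg_Iio {a : ℝ} : MapsTo (fun s : ℝ => -s) (Iio a) (Ioi (-a)) :=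
  fun _ hs => neg_lt_neg (mem_Iio.1 hs)

lemma mapsTo_neg_Ioi {a : ℝ} : MapsTo (fun s : ℝ => -s) (Ioi (-a)) (Iio a) :=
  fun _ hs => neg_lt.1 (mem_Ioi.1 hs)

lemma mapsTo_neg_Ici {a : ℝ} : MapsTo (fun s : ℝ => -s) (Ici (-a)) (Iic a) :=
  fun _ hs => neg_le.1 (mem_Ici.1 hs)

/-! ### Splitting a Bernstein function into small and large jumps -/

section BernsteinFunctions

variable {ρ : Measure ℝ}

lemma IsBernsteinLevyMeasure.isFiniteMeasure_restrict_Ioi (hρ : IsBernsteinLevyMeasure ρ) :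
    IsFiniteMeasure (ρ.restrict (Ioi 1)) := by
  refine ⟨?_⟩
  rw [Measure.restrict_apply_univ]
  refine lt_of_le_of_lt ?_ hρ.lintegral_min_lt_top
  calc ρ (Ioi 1) = ∫⁻ t in Ioi (1 : ℝ), ENNReal.ofReal (min t 1) ∂ρ := by
        rw [← setLIntegral_one]
        refine setLIntegral_congr_fun measurableSet_Ioi fun t ht => ?_
        simp [min_eq_right (le_of_lt (mem_Ioi.1 ht))]
    _ ≤ _ := lintegral_mono_set (Ioi_subset_Ioi zero_le_one)

lemma IsBernsteinLevyMeasure.lintegral_Ioc_lt_top (hρ : IsBernsteinLevyMeasure ρ) :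
    ∫⁻ t in Ioc (0 : ℝ) 1, ENNReal.ofReal t ∂ρ < ∞ := by
  refine lt_of_le_of_lt ?_ hρ.lintegral_min_lt_top
  calc ∫⁻ t in Ioc (0 : ℝ) 1, ENNReal.ofReal t ∂ρ
      = ∫⁻ t in Ioc (0 : ℝ) 1, ENNReal.ofReal (min t 1) ∂ρ :=
        setLIntegral_congr_fun measurableSet_Ioc fun t ht => by simp [min_eq_left ht.2]
    _ ≤ _ := lintegral_mono_set Ioc_subset_Ioi_self

lemma IsBernsteinLevyMeasure.integrableOn_Ioc (hρ : IsBernsteinLevyMeasure ρ) :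
    IntegrableOn (fun t : ℝ => t) (Ioc 0 1) ρ := by
  refine ⟨by fun_prop, (hasFiniteIntegral_iff_ofReal ?_).2 hρ.lintegral_Ioc_lt_top⟩
  filter_upwards [ae_restrict_mem measurableSet_Ioc] with t ht using ht.1.le

/-- The drift and the small jumps part of a Bernstein function. -/
noncomputable def smallJumpPart (β : ℝ) (ρ : Measure ℝ) (l : ℝ) : ℝ :=
  β * l + ∫ t in Ioc (0 : ℝ) 1, (1 - Real.exp (-(l * t))) ∂ρ

lemma IsBernsteinLevyMeasure.integrableOn_one_sub_cexp (hρ : IsBernsteinLevyMeasure ρ) (z : ℂ) :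
    IntegrableOn (fun t : ℝ => 1 - Complex.exp (-(z * t))) (Ioc 0 1) ρ := by
  refine Integrable.mono' (hρ.integrableOn_Ioc.const_mul (‖z‖ * Real.exp ‖z‖))
    (by fun_prop) ?_
  filter_upwards [ae_restrict_mem measurableSet_Ioc] with t ht
  have h := Complex.norm_exp_sub_sum_le_norm_mul_exp (-(z * t)) 1
  have hn : ‖-(z * (t : ℂ))‖ = ‖z‖ * t := by
    rw [norm_neg, norm_mul, Complex.norm_real, Real.norm_of_nonneg ht.1.le]
  simp only [Finset.sum_range_one, pow_zero, Nat.factorial_zero, Nat.cast_one, div_one, pow_one,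
    hn] at h
  rw [norm_sub_rev]
  refine h.trans ?_
  have h1 : ‖z‖ * t ≤ ‖z‖ := mul_le_of_le_one_right (norm_nonneg _) ht.2
  calc ‖z‖ * t * Real.exp (‖z‖ * t) ≤ ‖z‖ * t * Real.exp ‖z‖ :=
        mul_le_mul_of_nonneg_left (Real.exp_le_exp.2 h1)
          (mul_nonneg (norm_nonneg _) ht.1.le)
    _ = _ := by ring

/-- With a complex parameter, one differentiation under the integral already makes the small jump
integral entire, hence real-analytic on the line. -/
lemma IsBernsteinLevyMeasure.hasDerivAt_integral_one_sub_cexp (hρ : IsBernsteinLevyMeasure ρ)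
    (z : ℂ) :
    HasDerivAt (fun z : ℂ => ∫ t in Ioc (0 : ℝ) 1, (1 - Complex.exp (-(z * t))) ∂ρ)
      (∫ t in Ioc (0 : ℝ) 1, (t * Complex.exp (-(z * t)) : ℂ) ∂ρ) z := by
  refine (hasDerivAt_integral_of_dominated_loc_of_deriv_le
    (F := fun (z : ℂ) (t : ℝ) => 1 - Complex.exp (-(z * t)))
    (F' := fun (z : ℂ) (t : ℝ) => (t * Complex.exp (-(z * t)) : ℂ))
    (bound := fun t => t * Real.exp (‖z‖ + 1)) (Metric.ball_mem_nhds z zero_lt_one)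
    (Eventually.of_forall fun z => by fun_prop) (hρ.integrableOn_one_sub_cexp z)
    (by fun_prop) ?_ (hρ.integrableOn_Ioc.mul_const _) ?_).2
  · filter_upwards [ae_restrict_mem measurableSet_Ioc] with t ht w hw
    have hw' : ‖w‖ ≤ ‖z‖ + 1 := by
      have h1 : ‖w - z‖ < 1 := mem_ball_iff_norm.1 hw
      linarith [norm_le_norm_add_norm_sub' w z]
    rw [norm_mul, Complex.norm_real, Real.norm_of_nonneg ht.1.le]
    refine mul_le_mul_of_nonneg_left ((Complex.norm_exp_le_exp_norm _).trans
      (Real.exp_le_exp.2 ?_)) ht.1.le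
    rw [norm_neg, norm_mul, Complex.norm_real, Real.norm_of_nonneg ht.1.le]
    exact (mul_le_of_le_one_right (norm_nonneg _) ht.2).trans hw'
  · refine ae_of_all _ fun t w _ => ?_
    have h : HasDerivAt (fun w : ℂ => -(w * (t : ℂ))) (-(t : ℂ)) w := by
      simpa using! ((hasDerivAt_id w).mul_const (t : ℂ)).neg
    convert! (h.cexp.const_sub 1) using 1
    ring

lemma smallJumpPart_eq_re (β : ℝ) :
    smallJumpPart β ρ = fun l : ℝ => β * l +
      (∫ t in Ioc (0 : ℝ) 1, (1 - Complex.exp (-((l : ℂ) * t))) ∂ρ).re := by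
  ext l
  have : ∫ t in Ioc (0 : ℝ) 1, (1 - Complex.exp (-((l : ℂ) * t))) ∂ρ =
      ∫ t in Ioc (0 : ℝ) 1, ((1 - Real.exp (-(l * t)) : ℝ) : ℂ) ∂ρ := by
    simp
  rw [this, integral_complex_ofReal, smallJumpPart, Complex.ofReal_re]

lemma IsBernsteinLevyMeasure.analyticAt_smallJumpPart (hρ : IsBernsteinLevyMeasure ρ) (β x : ℝ) :
    AnalyticAt ℝ (smallJumpPart β ρ) x := by
  rw [smallJumpPart_eq_re]
  have hd : Differentiable ℂ
      (fun z : ℂ => ∫ t in Ioc (0 : ℝ) 1, (1 - Complex.exp (-(z * t))) ∂ρ) :=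
    fun z => (hρ.hasDerivAt_integral_one_sub_cexp z).differentiableAt
  exact (analyticAt_const.mul analyticAt_id).add (hd.analyticAt x).re_ofReal

lemma IsBernsteinLevyMeasure.hasDerivAt_smallJumpPart (hρ : IsBernsteinLevyMeasure ρ) (β x : ℝ) :
    HasDerivAt (smallJumpPart β ρ)
      (β + ∫ t in Ioc (0 : ℝ) 1, t * Real.exp (-(x * t)) ∂ρ) x := by
  rw [smallJumpPart_eq_re]
  have h := (hρ.hasDerivAt_integral_one_sub_cexp x).real_of_complex
  have heq : ∫ t in Ioc (0 : ℝ) 1, (t * Complex.exp (-((x : ℂ) * t)) : ℂ) ∂ρ =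
      ∫ t in Ioc (0 : ℝ) 1, ((t * Real.exp (-(x * t)) : ℝ) : ℂ) ∂ρ := by
    simp
  rw [heq, integral_complex_ofReal, Complex.ofReal_re] at h
  simpa using! ((hasDerivAt_id x).const_mul β).add h

/-- The weight `t` makes the possibly infinite measure `ρ` finite on `(0, 1]`, so higher derivatives
can be read off from those of an mgf. -/
lemma IsBernsteinLevyMeasure.deriv_smallJumpPart (hρ : IsBernsteinLevyMeasure ρ) (β : ℝ) :
    deriv (smallJumpPart β ρ) = fun x => β + mgf (fun t => -t)
      ((ρ.restrict (Ioc 0 1)).withDensity fun t => ENNReal.ofReal t) x := by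
  ext x
  rw [(hρ.hasDerivAt_smallJumpPart β x).deriv, mgf,
    integral_withDensity_eq_integral_toReal_smul (by fun_prop)
      (ae_of_all _ fun _ => ENNReal.ofReal_lt_top)]
  congr 1
  refine setIntegral_congr_fun measurableSet_Ioc fun t ht => ?_
  simp [ENNReal.toReal_ofReal ht.1.le]

lemma IsBernsteinLevyMeasure.iteratedDeriv_smallJumpPart_nonneg (hρ : IsBernsteinLevyMeasure ρ)
    {β : ℝ} (hβ : 0 ≤ β) (k : ℕ) (x : ℝ) :
    0 ≤ (-1 : ℝ) ^ k * iteratedDeriv (k + 1) (smallJumpPart β ρ) x := by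
  rw [iteratedDeriv_succ', hρ.deriv_smallJumpPart]
  set σ := (ρ.restrict (Ioc 0 1)).withDensity fun t => ENNReal.ofReal t with hσ
  have hfin : IsFiniteMeasure σ := isFiniteMeasure_withDensity hρ.lintegral_Ioc_lt_top.ne
  have hmem : ∀ᵐ t ∂σ, t ∈ Ioc (0 : ℝ) 1 :=
    (withDensity_absolutelyContinuous _ _).ae_le (ae_restrict_mem measurableSet_Ioc)
  rcases k with _ | k
  · simpa using add_nonneg hβ mgf_nonneg
  -- `-t` stays in `[-1, 0]`, so all exponential moments are finite.
  · have huniv : integrableExpSet (fun t : ℝ => -t) σ = univ := by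
      refine eq_univ_of_forall fun s => integrable_exp_mul_of_mem_Icc (a := -1) (b := 0)
        (by fun_prop) ?_
      filter_upwards [hmem] with t ht using ⟨by linarith [ht.2], by linarith [ht.1]⟩
    rw [iteratedDeriv_const_add (Nat.succ_pos k), iteratedDeriv_mgf (by simp [huniv]),
      ← integral_const_mul]
    refine integral_nonneg_of_ae ?_
    filter_upwards [hmem] with t ht
    have ht0 : 0 < t := ht.1
    rw [← mul_assoc, ← mul_pow]
    simp only [neg_mul, one_mul, neg_neg, Pi.zero_apply]
    positivity

/-- The maximal extension of the Bernstein function with drift `β` and Lévy measure `ρ`. -/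
noncomputable def bernsteinExtension (β : ℝ) (ρ : Measure ℝ) (x : ℝ) : ℝ :=
  smallJumpPart β ρ x + ρ.real (Ioi 1) - mgf id (ρ.restrict (Ioi 1)) (-x)

lemma ae_nonneg_restrict_Ioi_one : 0 ≤ᵐ[ρ.restrict (Ioi 1)] (id : ℝ → ℝ) := by
  filter_upwards [ae_restrict_mem measurableSet_Ioi] with t ht
  exact zero_le_one.trans (le_of_lt ht)

lemma IsBernsteinFunction.eqOn_bernsteinExtension {f : ℝ → ℝ} {β : ℝ}
    (hf : IsBernsteinFunction f β ρ) : EqOn (bernsteinExtension β ρ) f (Ioi 0) := by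
  intro l hl
  have := hf.levyMeasure.isFiniteMeasure_restrict_Ioi
  have h1 : IntegrableOn (fun t : ℝ => 1 - Real.exp (-(l * t))) (Ioc 0 1) ρ := by
    refine (hf.levyMeasure.integrableOn_one_sub_cexp l).re.congr (ae_of_all _ fun t => ?_)
    simp only [RCLike.re_eq_complex_re]
    rw [← Complex.ofReal_mul, ← Complex.ofReal_neg, ← Complex.ofReal_exp, ← Complex.ofReal_one,
      ← Complex.ofReal_sub, Complex.ofReal_re]
  have h2 : IntegrableOn (fun t : ℝ => Real.exp (-(l * t))) (Ioi 1) ρ := by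
    have h := mem_integrableExpSet_of_le (μ := ρ.restrict (Ioi 1)) aemeasurable_id
      ae_nonneg_restrict_Ioi_one zero_mem_integrableExpSet (neg_nonpos.2 (le_of_lt hl))
    simpa [integrableExpSet] using! h
  have h3 : IntegrableOn (fun _ : ℝ => (1 : ℝ)) (Ioi 1) ρ :=
    integrable_const (μ := ρ.restrict (Ioi 1)) 1
  rw [hf.eq_integral l hl, ← Ioc_union_Ioi_eq_Ioi (zero_le_one' ℝ),
    setIntegral_union (Ioc_disjoint_Ioi le_rfl) measurableSet_Ioi h1 (h3.sub h2),
    integral_sub h3 h2, bernsteinExtension, smallJumpPart, mgf]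
  simp
  ring

lemma IsBernsteinLevyMeasure.analyticAt_bernsteinExtension (hρ : IsBernsteinLevyMeasure ρ)
    {β x : ℝ} (hx : -x ∈ interior (integrableExpSet id (ρ.restrict (Ioi 1)))) :
    AnalyticAt ℝ (bernsteinExtension β ρ) x :=
  ((hρ.analyticAt_smallJumpPart β x).add analyticAt_const).sub
    ((analyticAt_mgf hx).fun_comp analyticAt_id.neg)

lemma IsBernsteinLevyMeasure.iteratedDeriv_bernsteinExtension (hρ : IsBernsteinLevyMeasure ρ)
    {β x : ℝ} (hx : -x ∈ interior (integrableExpSet id (ρ.restrict (Ioi 1)))) (k : ℕ) :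
    (-1 : ℝ) ^ k * iteratedDeriv (k + 1) (bernsteinExtension β ρ) x =
      (-1 : ℝ) ^ k * iteratedDeriv (k + 1) (smallJumpPart β ρ) x +
        ∫ t in Ioi (1 : ℝ), t ^ (k + 1) * Real.exp (-x * t) ∂ρ := by
  have hfun : bernsteinExtension β ρ = fun y => ρ.real (Ioi 1) +
      (smallJumpPart β ρ y - mgf id (ρ.restrict (Ioi 1)) (-y)) := by
    ext y
    simp only [bernsteinExtension]
    ring
  rw [hfun, iteratedDeriv_const_add (Nat.succ_pos k),
    iteratedDeriv_fun_sub (hρ.analyticAt_smallJumpPart β x).contDiffAt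
      ((analyticAt_mgf hx).fun_comp analyticAt_id.neg).contDiffAt,
    iteratedDeriv_comp_neg, iteratedDeriv_mgf hx, mul_sub, smul_eq_mul, ← mul_assoc, ← pow_add]
  -- The reflection contributes `(-1) ^ (k + 1)`; the remaining `-1` cancels the minus sign before
  -- the mgf.
  have : (-1 : ℝ) ^ (k + (k + 1)) = -1 := Odd.neg_one_pow ⟨k, by ring⟩
  rw [this]
  simp

end BernsteinFunctions

/-! ### The implications between moments and extensions -/

section ExponentialMoments

variable {f : ℝ → ℝ} {β : ℝ} {ρ : Measure ℝ} {α : ℝ}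

lemma IsBernsteinFunction.exists_extension (hf : IsBernsteinFunction f β ρ)
    (h : ∫⁻ s in Ioi (1 : ℝ), ENNReal.ofReal (Real.exp (α * s)) ∂ρ < ∞) :
    EqOn (bernsteinExtension β ρ) f (Ioi 0) ∧
      ContinuousOn (bernsteinExtension β ρ) (Ici (-α)) ∧
      AnalyticOnNhd ℝ (bernsteinExtension β ρ) (Ioi (-α)) ∧
      ∀ k : ℕ, 1 ≤ k → ∀ x ∈ Ioi (-α),
        0 ≤ (-1 : ℝ) ^ (k + 1) * iteratedDeriv k (bernsteinExtension β ρ) x := by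
  have hα : α ∈ integrableExpSet id (ρ.restrict (Ioi 1)) :=
    mem_integrableExpSet_of_lintegral_lt_top (X := id) aemeasurable_id h
  have hint : ∀ x ∈ Ioi (-α), -x ∈ interior (integrableExpSet id (ρ.restrict (Ioi 1))) :=
    fun x hx => Iio_subset_interior_integrableExpSet aemeasurable_id
      ae_nonneg_restrict_Ioi_one hα (mapsTo_neg_Ioi hx)
  refine ⟨hf.eqOn_bernsteinExtension, ?_,
    fun x hx => hf.levyMeasure.analyticAt_bernsteinExtension (hint x hx), ?_⟩
  · have hD : Continuous (smallJumpPart β ρ) := continuous_iff_continuousAt.2 fun x =>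
      (hf.levyMeasure.analyticAt_smallJumpPart β x).continuousAt
    refine (hD.add continuous_const).continuousOn.sub
      ((continuousOn_mgf_Iic aemeasurable_id ae_nonneg_restrict_Ioi_one hα).comp
        continuous_neg.continuousOn fun x hx => ?_)
    exact mapsTo_neg_Ici hx
  · rintro (_ | k) hk x hx
    · omega
    · rw [show (-1 : ℝ) ^ (k + 1 + 1) = (-1) ^ k by ring,
        hf.levyMeasure.iteratedDeriv_bernsteinExtension (hint x hx)]
      refine add_nonneg (hf.levyMeasure.iteratedDeriv_smallJumpPart_nonneg hf.drift_nonneg k x) ?_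
      refine setIntegral_nonneg measurableSet_Ioi fun t ht => ?_
      have : (0 : ℝ) < t := zero_lt_one.trans ht
      positivity

lemma IsBernsteinFunction.lintegral_exp_lt_top_of_analyticOnNhd (hf : IsBernsteinFunction f β ρ)
    (hα : 0 < α) {F : ℝ → ℝ} (hF : EqOn F f (Ioi 0)) (hFc : ContinuousOn F (Ici (-α)))
    (hFa : AnalyticOnNhd ℝ F (Ioi (-α))) :
    ∫⁻ s in Ioi (1 : ℝ), ENNReal.ofReal (Real.exp (α * s)) ∂ρ < ∞ := by
  have := hf.levyMeasure.isFiniteMeasure_restrict_Ioi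
  have hD : ∀ s, AnalyticAt ℝ (fun s => smallJumpPart β ρ (-s)) s := fun s =>
    (hf.levyMeasure.analyticAt_smallJumpPart β (-s)).fun_comp analyticAt_id.neg
  refine lintegral_exp_mul_lt_top_of_analyticOnNhd (μ := ρ.restrict (Ioi 1)) (X := id)
    (G := fun s => smallJumpPart β ρ (-s) + ρ.real (Ioi 1) - F (-s)) aemeasurable_id
    ae_nonneg_restrict_Ioi_one hα.le (fun s hs => ?_) ?_ fun s hs => ?_
  · have hs' : -s ∈ Ioi (-α) := mapsTo_neg_Iio hs
    exact ((hD s).add analyticAt_const).sub ((hFa _ hs').fun_comp analyticAt_id.neg)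
  · refine ((hD α).continuousAt.continuousWithinAt.add continuousWithinAt_const).sub ?_
    exact (hFc (-α) self_mem_Ici).comp continuous_neg.continuousWithinAt
      fun s hs => Ioi_subset_Ici_self (mapsTo_neg_Iio hs)
  · have hs' : -s ∈ Ioi (0 : ℝ) := neg_pos.2 (mem_Iio.1 hs)
    simp only [hF hs', ← hf.eqOn_bernsteinExtension hs', bernsteinExtension, neg_neg]
    ring

lemma IsBernsteinFunction.lintegral_exp_lt_top_of_iteratedDeriv_nonneg
    (hf : IsBernsteinFunction f β ρ) (hα : 0 < α) {F : ℝ → ℝ} (hF : EqOn F f (Ioi 0))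
    (hFc : ContinuousOn F (Ici (-α))) (hFs : ContDiffOn ℝ (⊤ : ℕ∞) F (Ioi (-α)))
    (hpos : ∀ k : ℕ, 1 ≤ k → ∀ x ∈ Ioi (-α), 0 ≤ (-1 : ℝ) ^ (k + 1) * iteratedDeriv k F x) :
    ∫⁻ s in Ioi (1 : ℝ), ENNReal.ofReal (Real.exp (α * s)) ∂ρ < ∞ := by
  have := hf.levyMeasure.isFiniteMeasure_restrict_Ioi
  set K : ℝ → ℝ := fun s => -F (-s) with hK
  have hKd : ∀ k s, iteratedDeriv (k + 1) K s = (-1 : ℝ) ^ k * iteratedDeriv (k + 1) F (-s) := by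
    intro k s
    rw [hK, iteratedDeriv_fun_neg, iteratedDeriv_comp_neg, smul_eq_mul]
    ring
  have hKs : ContDiffOn ℝ (⊤ : ℕ∞) K (Iio α) := (hFs.comp contDiff_neg.contDiffOn mapsTo_neg_Iio).neg
  have hKpos : ∀ k : ℕ, ∀ x < α, 0 ≤ iteratedDeriv (k + 1) K x := fun k x hx => by
    have h := hpos (k + 1) (by omega) (-x) (neg_lt_neg hx)
    rw [hKd]
    convert h using 2
    ring
  -- The centre `-1` is safe: the moments there are finite because `ρ` is finite on `(1, ∞)`, and
  -- `F` is `f` near `1`.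
  have hint : (-1 : ℝ) ∈ interior (integrableExpSet id (ρ.restrict (Ioi 1))) :=
    Iio_subset_interior_integrableExpSet aemeasurable_id ae_nonneg_restrict_Ioi_one
      zero_mem_integrableExpSet (by norm_num)
  have hmom : ∀ k : ℕ, ∫ t in Ioi (1 : ℝ), id t ^ (k + 1) * Real.exp (-1 * id t) ∂ρ ≤
      iteratedDeriv (k + 1) K (-1) := fun k => by
    have hev : F =ᶠ[𝓝 1] bernsteinExtension β ρ := by
      filter_upwards [Ioi_mem_nhds (zero_lt_one' ℝ)] with x hx
      rw [hF hx, hf.eqOn_bernsteinExtension hx]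
    rw [hKd, neg_neg, (hev.iteratedDeriv (k + 1)).eq_of_nhds,
      hf.levyMeasure.iteratedDeriv_bernsteinExtension hint]
    exact le_add_of_nonneg_left
      (hf.levyMeasure.iteratedDeriv_smallJumpPart_nonneg hf.drift_nonneg k 1)
  have hm0 : ∀ k : ℕ, 0 ≤ ∫ t in Ioi (1 : ℝ), id t ^ k * Real.exp (-1 * id t) ∂ρ := fun k =>
    setIntegral_nonneg measurableSet_Ioi fun t ht => by
      have : (0 : ℝ) < id t := zero_lt_one.trans ht
      positivity
  -- The derivative comparison starts at order one, so the zeroth moment is carried separately.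
  set m : ℝ := ∫ t in Ioi (1 : ℝ), id t ^ 0 * Real.exp (-1 * id t) ∂ρ with hm
  have hKc : Tendsto (fun s => m + (K s - K (-1))) (𝓝[<] α) (𝓝 (m + (K α - K (-1)))) := by
    refine (Tendsto.sub_const ?_ _).const_add _
    exact ((hFc (-α) self_mem_Ici).comp continuous_neg.continuousWithinAt
      fun s hs => Ioi_subset_Ici_self (mapsTo_neg_Iio hs)).neg
  refine lintegral_exp_mul_lt_top_of_le (μ := ρ.restrict (Ioi 1)) (X := id) aemeasurable_id hKc ?_
  filter_upwards [Ioo_mem_nhdsLT (show (-1 : ℝ) < α by linarith)] with s hs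
  have hδ : 0 ≤ s - -1 := by linarith [hs.1]
  have hsplit := lintegral_exp_add_mul_eq_tsum (ae_nonneg_restrict_Ioi_one (ρ := ρ)) hint hδ
  rw [add_sub_cancel, tsum_eq_zero_add' ENNReal.summable, ← hm] at hsplit
  have hKm : 0 ≤ K s - K (-1) := by
    simpa using sum_iteratedDeriv_succ_le_sub hs.1 hs.2 hKs hKpos 0
  rw [hsplit, ENNReal.ofReal_add (hm0 0) hKm]
  refine add_le_add (by rw [Nat.factorial_zero, Nat.cast_one, div_one, pow_zero, mul_one])
    (ENNReal.tsum_le_of_sum_range_le fun n => ?_)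
  rw [← ENNReal.ofReal_sum_of_nonneg fun k _ => by have := hm0 (k + 1); positivity]
  refine ENNReal.ofReal_le_ofReal ((Finset.sum_le_sum fun k _ => ?_).trans
    (sum_iteratedDeriv_succ_le_sub hs.1 hs.2 hKs hKpos n))
  have := hmom k
  gcongr

variable {Ω : Type*} [MeasurableSpace Ω] {T : ℝ≥0 → Ω → ℝ} {P : Measure Ω}

lemma IsSubordinator.ae_nonneg (hT : IsSubordinator T P) (t : ℝ≥0) : 0 ≤ᵐ[P] T t := by
  filter_upwards [hT.zero, hT.monotone] with ω h0 hm
  have := hm (zero_le (a := t))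
  simp only [h0] at this
  exact this

lemma IsSubordinatorOf.mgf_eq (hT : IsSubordinatorOf T P f) {t : ℝ≥0} (ht : 0 < t) {s : ℝ}
    (hs : s < 0) : mgf (T t) P s = Real.exp (-(t * f (-s))) := by
  rw [← hT.laplace t ht (-s) (neg_pos.2 hs), mgf]
  simp

/-- Solving `E e^{-x T_t} = e^{-t f(x)}` for `f` gives the extension; the mgf is positive wherever
it is finite, so its logarithm is as regular as the mgf. -/
lemma IsSubordinatorOf.exists_extension [IsProbabilityMeasure P] (hT : IsSubordinatorOf T P f)
    {t : ℝ≥0} (ht : 0 < t) (h : ∫⁻ ω, ENNReal.ofReal (Real.exp (α * T t ω)) ∂P < ∞) :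
    ∃ F : ℝ → ℝ, EqOn F f (Ioi 0) ∧ ContinuousOn F (Ici (-α)) ∧
      AnalyticOnNhd ℝ F (Ioi (-α)) := by
  have hm := (hT.measurable t).aemeasurable (μ := P)
  have h0 := hT.ae_nonneg t
  have hαS := mem_integrableExpSet_of_lintegral_lt_top hm h
  refine ⟨fun x => -(t : ℝ)⁻¹ * cgf (T t) P (-x), fun x hx => ?_, ?_, fun x hx => ?_⟩
  · have htr : (t : ℝ) ≠ 0 := by exact_mod_cast ht.ne'
    simp only [cgf, hT.mgf_eq ht (neg_neg_of_pos hx), Real.log_exp, neg_neg]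
    field_simp
  · refine continuousOn_const.mul (ContinuousOn.log ?_ fun x hx => ?_)
    · exact (continuousOn_mgf_Iic hm h0 hαS).comp continuous_neg.continuousOn
        mapsTo_neg_Ici
    · exact (mgf_pos (mem_integrableExpSet_of_le hm h0 hαS (mapsTo_neg_Ici hx))).ne'
  · exact analyticAt_const.mul ((analyticAt_cgf (Iio_subset_interior_integrableExpSet hm h0 hαS
      (mapsTo_neg_Ioi hx))).fun_comp analyticAt_id.neg)

lemma IsSubordinatorOf.lintegral_exp_lt_top_of_analyticOnNhd [IsProbabilityMeasure P]
    (hT : IsSubordinatorOf T P f) (hα : 0 < α) {F : ℝ → ℝ} (hF : EqOn F f (Ioi 0))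
    (hFc : ContinuousOn F (Ici (-α))) (hFa : AnalyticOnNhd ℝ F (Ioi (-α))) {t : ℝ≥0}
    (ht : 0 < t) : ∫⁻ ω, ENNReal.ofReal (Real.exp (α * T t ω)) ∂P < ∞ := by
  refine lintegral_exp_mul_lt_top_of_analyticOnNhd (G := fun s => Real.exp (-(t * F (-s))))
    (hT.measurable t).aemeasurable (hT.ae_nonneg t) hα.le (fun s hs => ?_) ?_ fun s hs => ?_
  · have hs' : -s ∈ Ioi (-α) := mapsTo_neg_Iio hs
    exact (analyticAt_const.mul ((hFa _ hs').fun_comp analyticAt_id.neg)).neg.rexp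
  · have h : ContinuousWithinAt (fun s => F (-s)) (Iio α) α :=
      (hFc (-α) self_mem_Ici).comp continuous_neg.continuousWithinAt
        fun s hs => Ioi_subset_Ici_self (mapsTo_neg_Iio hs)
    exact (continuousWithinAt_const.mul h).neg.rexp
  · simp only [hT.mgf_eq ht hs, hF (show -s ∈ Ioi (0 : ℝ) from neg_pos.2 (mem_Iio.1 hs))]

end ExponentialMoments

theorem lemma4p1 {Ω : Type*} [MeasurableSpace Ω] (P : Measure Ω) [IsProbabilityMeasure P]
    (f : ℝ → ℝ) (β : ℝ) (ρ : Measure ℝ) (hf : IsBernsteinFunction f β ρ)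
    (T : ℝ≥0 → Ω → ℝ) (hT : IsSubordinatorOf T P f)
    (α : ℝ) (hα : 0 < α) :
    List.TFAE [
      -- a) for some `t > 0`
      ∃ t : ℝ≥0, 0 < t ∧ ∫⁻ ω, ENNReal.ofReal (Real.exp (α * T t ω)) ∂P < ∞,
      -- a) for all `t > 0`
      ∀ t : ℝ≥0, 0 < t → ∫⁻ ω, ENNReal.ofReal (Real.exp (α * T t ω)) ∂P < ∞,
      -- b)
      ∫⁻ s in Ioi (1 : ℝ), ENNReal.ofReal (Real.exp (α * s)) ∂ρ < ∞,
      -- c)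
      ∃ F : ℝ → ℝ, EqOn F f (Ioi 0) ∧ ContinuousOn F (Ici (-α)) ∧
        ContDiffOn ℝ (⊤ : ℕ∞) F (Ioi (-α)) ∧
        ∀ k : ℕ, 1 ≤ k → ∀ x ∈ Ioi (-α), 0 ≤ (-1 : ℝ) ^ (k + 1) * iteratedDeriv k F x,
      -- d)
      ∃ F : ℝ → ℝ, EqOn F f (Ioi 0) ∧ ContinuousOn F (Ici (-α)) ∧
        AnalyticOnNhd ℝ F (Ioi (-α))] := by
  tfae_have 2 → 1 := fun h => ⟨1, one_pos, h 1 one_pos⟩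
  tfae_have 1 → 5 := fun ⟨_, ht, h⟩ => hT.exists_extension ht h
  tfae_have 5 → 2 := fun ⟨_, hF, hFc, hFa⟩ _ ht =>
    hT.lintegral_exp_lt_top_of_analyticOnNhd hα hF hFc hFa ht
  tfae_have 5 → 3 := fun ⟨_, hF, hFc, hFa⟩ =>
    hf.lintegral_exp_lt_top_of_analyticOnNhd hα hF hFc hFa
  tfae_have 3 → 4 := fun h =>
    have ⟨hF, hFc, hFa, hFd⟩ := hf.exists_extension h
    ⟨_, hF, hFc, hFa.contDiffOn (uniqueDiffOn_Ioi _), hFd⟩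
  tfae_have 4 → 3 := fun ⟨_, hF, hFc, hFs, hFd⟩ =>
    hf.lintegral_exp_lt_top_of_iteratedDeriv_nonneg hα hF hFc hFs hFd
  tfae_have 3 → 5 := fun h =>
    have ⟨hF, hFc, hFa, _⟩ := hf.exists_extension h
    ⟨_, hF, hFc, hFa⟩
  tfae_finish
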